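/- Let $\mathcal G$ be a connected metric graph with finitely many edges: bounded edges $e$, each identified with an interval $[0,\ell_e]$, $0<\ell_e<\infty$, and half-lines, each identified with $[0,\infty)$; loops and multiple edges are allowed. Assume that $\mathcal G$ has at least one half-line and that its compact core $\mathcal K$ (the subgraph of the bounded edges) is non-empty. A terminal edge is an edge ending at a vertex of degree $1$; a cut edge of $\mathcal K$ is a bounded edge whose removal disconnects its two endpoints. Let $H^1(\mathcal G)$ be the space of real functions that are continuous on $\mathcal G$ and of class $H^1$ on each edge, and put $$C_{\mathcal K}:=\sup_{0\neq u\in H^1(\mathcal G)}\frac{\|u\|_{L^6(\mathcal K)}^6}{\|u\|_{L^2(\mathcal G)}^4\,\|u'\|_{L^2(\mathcal G)}^2},\qquad \mu_{\mathcal K}:=\sqrt{\frac{3}{C_{\mathcal K}}},\qquad \mu_{\mathbb R^+}:=\frac{\sqrt3\,\pi}{4},$$ so that $\mu_{\mathcal K}$ is the reduced critical mass of $\mathcal G$ and $\mu_{\mathbb R^+}$ the critical mass of the half-line. **Theorem.** Neither of the estimates $\mu_{\mathbb R^+}<\mu_{\mathcal K}<\sqrt3$, known for graphs as above with exactly one half-line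 and no terminal edges, can be improved in general. More precisely: 1. for every $\varepsilon>0$ and every $\ell$ there is such a graph $\mathcal G$, with exactly one half-line and no terminal edges, whose compact core has a cut edge of length at least $\ell$, such that $C_{\mathcal K}<\infty$ and $\mu_{\mathcal K}\le\mu_{\mathbb R^+}+\varepsilon$; 2. there is a constant $D$ such that for every $\varepsilon>0$ and every $L$ there is such a graph $\mathcal G$, with exactly one half-line and no terminal edges, whose compact core has diameter at most $D$ (in its shortest-path distance) and total length at least $L$, such that $C_{\mathcal K}<\infty$ and $\mu_{\mathcal K}\ge\sqrt3-\varepsilon$. -/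

import Mathlib

open MeasureTheory
open scoped ENNReal

/-- A metric graph with finitely many edges: a multigraph (loops and multiple edges are allowed)
whose bounded edges `e` are identified with `[0, len e]`, the coordinate `0` being the vertex
`src e` and `len e` the vertex `tgt e`, and whose half-lines `h` are identified with `[0, ∞)`,
the coordinate `0` being the vertex `origin h`. -/
structure MetricGraph where
  /-- vertices -/
  V : Type
  /-- bounded edges -/
  E : Type
  /-- half-lines -/
  H : Type
  fintypeE : Fintype E
  fintypeH : Fintype H
  src : E → V
  tgt : E → V
  len : E → ℝ
  len_pos : ∀ e, 0 < len e
  origin : H → V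

namespace MetricGraph

instance (G : MetricGraph) : Fintype G.E := G.fintypeE

instance (G : MetricGraph) : Fintype G.H := G.fintypeH

/-! ### Topology of the graph -/

/-- `v` and `w` are the endpoints of a bounded edge that belongs to `S`. -/
def AdjIn (G : MetricGraph) (S : Set G.E) (v w : G.V) : Prop :=
  ∃ e ∈ S, (G.src e = v ∧ G.tgt e = w) ∨ (G.src e = w ∧ G.tgt e = v)

/-- `v` and `w` are joined by a path of bounded edges that belong to `S`. -/
def JoinedIn (G : MetricGraph) (S : Set G.E) : G.V → G.V → Prop :=
  Relation.ReflTransGen (G.AdjIn S)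

/-- Connectedness. Half-lines have only one vertex, so they cannot join two vertices. -/
def Connected (G : MetricGraph) : Prop :=
  Nonempty G.V ∧ ∀ v w, G.JoinedIn Set.univ v w

/-- The degree of a vertex: the number of ends of edges at `v` (a loop counts twice). -/
noncomputable def degree (G : MetricGraph) (v : G.V) : ℕ :=
  Nat.card {e : G.E // G.src e = v} + Nat.card {e : G.E // G.tgt e = v} +
    Nat.card {h : G.H // G.origin h = v}

/-- No edge ends with a vertex of degree one. -/
def NoTerminalEdge (G : MetricGraph) : Prop :=
  (∀ e, G.degree (G.src e) ≠ 1 ∧ G.degree (G.tgt e) ≠ 1) ∧ ∀ h, G.degree (G.origin h) ≠ 1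

/-- The standing assumption on graphs: connected, noncompact (there is a half-line), with
nonempty compact core (there is a bounded edge). Finiteness is part of `MetricGraph`. -/
structure Admissible (G : MetricGraph) : Prop where
  connected : G.Connected
  noncompact : Nonempty G.H
  core_nonempty : Nonempty G.E

/-- `G` is an admissible graph with exactly one half-line and no terminal edges. -/
structure OneHalfLineNoTerminal (G : MetricGraph) : Prop where
  admissible : G.Admissible
  oneHalfLine : Nat.card G.H = 1
  noTerminalEdge : G.NoTerminalEdge

/-- A cut edge of the compact core: a bounded edge whose removal separates its endpoints, i.e.
it is the only connection between two disjoint subgraphs. -/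
def IsCutEdge (G : MetricGraph) (e : G.E) : Prop :=
  ¬ G.JoinedIn {e}ᶜ (G.src e) (G.tgt e)

/-! ### Length and diameter of the compact core -/

/-- The total length of the compact core. -/
noncomputable def coreLength (G : MetricGraph) : ℝ := ∑ e, G.len e

/-- The points of the compact core, as pairs (bounded edge, coordinate on it); the pairs that
represent the same vertex are identified by `CorePath.glue`. -/
def corePoints (G : MetricGraph) : Set (G.E × ℝ) :=
  {p | p.2 ∈ Set.Icc 0 (G.len p.1)}

/-- `p` represents the vertex `v`. -/
def Represents (G : MetricGraph) (p : G.E × ℝ) (v : G.V) : Prop :=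
  (p.2 = 0 ∧ G.src p.1 = v) ∨ (p.2 = G.len p.1 ∧ G.tgt p.1 = v)

/-- `G.CorePath p q a`: the points `p` and `q` of the compact core are joined by a path of
length `a` in the compact core, made of finitely many segments of edges. -/
inductive CorePath (G : MetricGraph) : G.E × ℝ → G.E × ℝ → ℝ → Prop
  | segment (e : G.E) (s t : ℝ) (hs : s ∈ Set.Icc 0 (G.len e)) (ht : t ∈ Set.Icc 0 (G.len e)) :
      CorePath G (e, s) (e, t) |s - t|
  | glue (p q : G.E × ℝ) (v : G.V) (hp : G.Represents p v) (hq : G.Represents q v) :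
      CorePath G p q 0
  | trans (p q r : G.E × ℝ) (a b : ℝ) (h₁ : CorePath G p q a) (h₂ : CorePath G q r b) :
      CorePath G p r (a + b)

/-- The shortest path distance of the compact core. -/
noncomputable def coreEDist (G : MetricGraph) (p q : G.E × ℝ) : ℝ≥0∞ :=
  ⨅ (a : ℝ) (_ : G.CorePath p q a), ENNReal.ofReal a

/-- The diameter of the compact core. -/
noncomputable def coreDiam (G : MetricGraph) : ℝ≥0∞ :=
  ⨆ p ∈ G.corePoints, ⨆ q ∈ G.corePoints, G.coreEDist p q

/-! ### The Sobolev space and the reduced critical mass -/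

/-- For an interval `I` with left endpoint `0 ∈ I`: (the continuous representative) `u` belongs
to `H¹(I)` and has weak derivative `u'`. Only the restrictions of `u` and `u'` to `I` matter. -/
structure HasH1DerivOn (I : Set ℝ) (u u' : ℝ → ℝ) : Prop where
  memLp : MemLp u 2 (volume.restrict I)
  memLp_deriv : MemLp u' 2 (volume.restrict I)
  eq_integral : ∀ x ∈ I, u x = u 0 + ∫ t in (0 : ℝ)..x, u' t

/-- An element of `H¹(G)`: a family of `H¹` functions on the edges, continuous on `G`, which means
that they take the same value `val v` at each vertex `v`. Their weak derivatives, determined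
almost everywhere by the functions, are recorded too. -/
structure H1 (G : MetricGraph) where
  onE : G.E → ℝ → ℝ
  onE' : G.E → ℝ → ℝ
  onH : G.H → ℝ → ℝ
  onH' : G.H → ℝ → ℝ
  val : G.V → ℝ
  h1_onE : ∀ e, HasH1DerivOn (Set.Icc 0 (G.len e)) (onE e) (onE' e)
  h1_onH : ∀ h, HasH1DerivOn (Set.Ici 0) (onH h) (onH' h)
  onE_src : ∀ e, onE e 0 = val (G.src e)
  onE_tgt : ∀ e, onE e (G.len e) = val (G.tgt e)
  onH_origin : ∀ h, onH h 0 = val (G.origin h)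

/-- The mass `‖u‖²` in `L²(G)`. -/
noncomputable def mass {G : MetricGraph} (u : G.H1) : ℝ :=
  (∑ e, ∫ x in Set.Icc 0 (G.len e), u.onE e x ^ 2) + ∑ h, ∫ x in Set.Ici (0 : ℝ), u.onH h x ^ 2

/-- `‖u'‖²` in `L²(G)`. -/
noncomputable def kinetic {G : MetricGraph} (u : G.H1) : ℝ :=
  (∑ e, ∫ x in Set.Icc 0 (G.len e), u.onE' e x ^ 2) + ∑ h, ∫ x in Set.Ici (0 : ℝ), u.onH' h x ^ 2

/-- `‖u‖⁶` in `L⁶(K)`, where `K` is the compact core. -/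
noncomputable def coreSix {G : MetricGraph} (u : G.H1) : ℝ :=
  ∑ e, ∫ x in Set.Icc 0 (G.len e), |u.onE e x| ^ 6

/-- The values of `Q(u) = ‖u‖⁶_{6,K} / (‖u‖⁴_{2,G} ‖u'‖²_{2,G})` for `0 ≠ u ∈ H¹(G)`. On a connected
noncompact graph, `u ≠ 0` forces `u' ≠ 0`. -/
def quotients (G : MetricGraph) : Set ℝ :=
  {q | ∃ u : G.H1, mass u ≠ 0 ∧ q = coreSix u / (mass u ^ 2 * kinetic u)}

/-- The optimal constant `C_K` of the Gagliardo–Nirenberg inequality localized on the compact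
core, `C_K = sup Q`. -/
noncomputable def optimalConstant (G : MetricGraph) : ℝ := sSup G.quotients

/-- The reduced critical mass `μ_K = √(3 / C_K)`. -/
noncomputable def reducedCriticalMass (G : MetricGraph) : ℝ := √(3 / G.optimalConstant)

end MetricGraph

/-- The critical mass of the half-line, `μ_{ℝ⁺} = √3 π / 4`. -/
noncomputable def halfLineCriticalMass : ℝ := √3 * Real.pi / 4

/-! Both bounds are approached by explicit families of graphs. For the lower bound, take a dumbbell
whose handle is a cut edge of length `l` and whose loops have length `r = 1 / l`; the far loop
removes the terminal edge. Half of the soliton `1 / √cosh`, with its peak at the far end of the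
handle, continues along the half-line and is extended to the loops by constants, which costs mass at
most `2 * r` and no kinetic energy. As `l → ∞` the mass tends to `π / 2`, the kinetic energy is `π /
16`, and the part of the sixth power on the handle tends to `π / 4`. The limiting quotient `16 / π ^
2` gives `√3 * π / 4` (`dumbbell_reducedCriticalMass_le`). For the upper bound, take a rose with `N`
unit petals. On a loop, `u ^ 2` exceeds its value `c` at the vertex by at most `√(m * k)`, with `m`,
`k` the mass and kinetic energy of the petal; if `c` were `0`, this would give `C ≤ 1`, that is,
`√3`. A small `c` costs only a factor close to `1`. A large `c` forces the mass to spread over all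
petals, since each must carry about `c`; the half-line bound `c ≤ 2 * √(a * b)` then suffices. This
dichotomy is `rose_inequality`. -/

/-- The Cauchy–Schwarz inequality in `L²`. -/
theorem integral_abs_mul_le_sqrt {α : Type*} [MeasurableSpace α] {μ : Measure α} {f g : α → ℝ}
    (hf : MemLp f 2 μ) (hg : MemLp g 2 μ) :
    ∫ x, |f x * g x| ∂μ ≤ √((∫ x, f x ^ 2 ∂μ) * ∫ x, g x ^ 2 ∂μ) := by
  have h := integral_mul_le_Lp_mul_Lq_of_nonneg (μ := μ) Real.HolderConjugate.two_two
    (f := fun x => |f x|) (g := fun x => |g x|) (.of_forall fun x => abs_nonneg _)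
    (.of_forall fun x => abs_nonneg _)
    (by rw [ENNReal.ofReal_ofNat]; exact hf.abs) (by rw [ENNReal.ofReal_ofNat]; exact hg.abs)
  rw [Real.sqrt_mul (integral_nonneg fun x => sq_nonneg _)]
  simpa [abs_mul, Real.sqrt_eq_rpow] using h


/-! ### Pointwise estimates for `H¹` functions on an interval -/

namespace MetricGraph.HasH1DerivOn

variable {I : Set ℝ} {u u' : ℝ → ℝ}

theorem integrableOn_mul (h : HasH1DerivOn I u u') : IntegrableOn (fun x => u x * u' x) I :=
  h.memLp.integrable_mul h.memLp_deriv

theorem integrableOn_sq (h : HasH1DerivOn I u u') : IntegrableOn (fun x => u x ^ 2) I :=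
  h.memLp.integrable_sq

theorem intervalIntegrable_deriv (h : HasH1DerivOn I u u') {b : ℝ} (hb : 0 ≤ b)
    (hI : Set.Icc 0 b ⊆ I) : IntervalIntegrable u' volume 0 b := by
  rw [intervalIntegrable_iff_integrableOn_Icc_of_le hb]
  have := h.memLp_deriv.mono_measure (Measure.restrict_mono hI le_rfl)
  exact this.integrable (by norm_num)

/-- The chain rule for the square of an `H¹` function. -/
theorem sq_sub_sq_zero (h : HasH1DerivOn I u u') {b : ℝ} (hb : 0 ≤ b) (hI : Set.Icc 0 b ⊆ I) :
    u b ^ 2 - u 0 ^ 2 = 2 * ∫ x in (0 : ℝ)..b, u x * u' x := by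
  have hint := h.intervalIntegrable_deriv hb hI
  -- `u` is controlled only on `I`; `g` agrees with it there and is a primitive on the whole line,
  -- so it has derivative `u'` almost everywhere on the interval.
  set g : ℝ → ℝ := fun x => u 0 + ∫ t in (0 : ℝ)..x, u' t with hg
  have hgu : ∀ x ∈ Set.Icc 0 b, u x = g x := fun x hx => h.eq_integral x (hI hx)
  have hac : AbsolutelyContinuousOnInterval g 0 b :=
    AbsolutelyContinuousOnInterval.fun_add
      (contDiffOn_const (n := 1)).absolutelyContinuousOnInterval
      (hint.absolutelyContinuousOnInterval_intervalIntegral (by simp))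
  have key := hac.integral_deriv_mul_eq_sub hac
  rw [hgu b ⟨hb, le_rfl⟩, hgu 0 ⟨le_rfl, hb⟩, sq, sq, ← key,
    ← intervalIntegral.integral_const_mul]
  apply intervalIntegral.integral_congr_ae
  filter_upwards [hint.ae_hasDerivAt_integral] with x hx hxm
  have hx' : x ∈ Set.uIcc 0 b := Set.uIoc_subset_uIcc hxm
  have hd : deriv g x = u' x := ((hx hx' 0 (by simp)).const_add _).deriv
  rw [hd, hgu x (by simpa [Set.uIcc_of_le hb] using hx')]
  ring

theorem abs_sq_sub_sq_le (h : HasH1DerivOn I u u') {a b : ℝ} (ha : 0 ≤ a) (hab : a ≤ b)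
    (hI : Set.Icc 0 b ⊆ I) :
    |u b ^ 2 - u a ^ 2| ≤ 2 * ∫ x in a..b, |u x * u' x| := by
  have hb := ha.trans hab
  have h1 := h.sq_sub_sq_zero hb hI
  have h2 := h.sq_sub_sq_zero ha ((Set.Icc_subset_Icc_right hab).trans hI)
  have hi : IntervalIntegrable (fun x => u x * u' x) volume 0 b := by
    rw [intervalIntegrable_iff_integrableOn_Icc_of_le hb]
    exact h.integrableOn_mul.mono_set hI
  have hau : a ∈ Set.uIcc 0 b := by simp [Set.mem_uIcc, ha, hab]
  have h3 := intervalIntegral.integral_interval_sub_left hi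
    (hi.mono_set (Set.uIcc_subset_uIcc_left hau))
  have : u b ^ 2 - u a ^ 2 = 2 * ∫ x in a..b, u x * u' x := by
    rw [← h3]; linarith
  rw [this, abs_mul, abs_two]
  gcongr
  exact intervalIntegral.abs_integral_le_integral_abs hab

theorem integral_abs_mul_le (h : HasH1DerivOn I u u') {a b : ℝ}
    (ha : 0 ≤ a) (hab : a ≤ b) (hI : Set.Icc 0 b ⊆ I) :
    ∫ x in a..b, |u x * u' x| ≤ √((∫ x in I, u x ^ 2) * ∫ x in I, u' x ^ 2) := by
  refine le_trans ?_ (integral_abs_mul_le_sqrt h.memLp h.memLp_deriv)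
  rw [intervalIntegral.integral_of_le hab]
  exact setIntegral_mono_set h.integrableOn_mul.abs (.of_forall fun x => abs_nonneg _)
    (LE.le.eventuallyLE fun x hx => hI ⟨ha.trans hx.1.le, hx.2⟩)

/-- The oscillation of the square of an `H¹` function. -/
theorem sq_le_sq_add (h : HasH1DerivOn I u u') {a b : ℝ}
    (ha : 0 ≤ a) (hb : 0 ≤ b) (haI : Set.Icc 0 a ⊆ I) (hbI : Set.Icc 0 b ⊆ I) :
    u b ^ 2 ≤ u a ^ 2 + 2 * √((∫ x in I, u x ^ 2) * ∫ x in I, u' x ^ 2) := by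
  rcases le_total a b with hab | hab
  · have h1 := (abs_le.1 (h.abs_sq_sub_sq_le ha hab hbI)).2
    have h2 := h.integral_abs_mul_le ha hab hbI
    linarith
  · have h1 := (abs_le.1 (h.abs_sq_sub_sq_le hb hab haI)).1
    have h2 := h.integral_abs_mul_le hb hab haI
    linarith

/-- On a loop the oscillation of the square of an `H¹` function around its value at the vertex
gains a factor `2`, since every point is reached from both sides. -/
theorem abs_sq_sub_sq_le_of_loop {l : ℝ} (h : HasH1DerivOn (Set.Icc 0 l) u u') (hl : u l = u 0)
    {x : ℝ} (hx : x ∈ Set.Icc 0 l) :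
    |u x ^ 2 - u 0 ^ 2| ≤
      √((∫ x in Set.Icc 0 l, u x ^ 2) * ∫ x in Set.Icc 0 l, u' x ^ 2) := by
  have h1 := h.abs_sq_sub_sq_le le_rfl hx.1 (Set.Icc_subset_Icc_right hx.2)
  have h2 := h.abs_sq_sub_sq_le hx.1 hx.2 le_rfl
  rw [hl, abs_sub_comm] at h2
  have hl0 := hx.1.trans hx.2
  have h3 := h.integral_abs_mul_le le_rfl hl0 le_rfl
  have hi : IntervalIntegrable (fun x => |u x * u' x|) volume 0 l := by
    rw [intervalIntegrable_iff_integrableOn_Icc_of_le hl0]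
    exact h.integrableOn_mul.abs
  have hxu : x ∈ Set.uIcc 0 l := by simpa [Set.uIcc_of_le hl0] using hx
  -- The two arcs from the vertex to `x` make up the loop: adding `h1` and `h2` bounds twice the
  -- oscillation by twice the integral over the loop.
  have h4 := intervalIntegral.integral_add_adjacent_intervals
    (hi.mono_set (Set.uIcc_subset_uIcc_left hxu)) (hi.mono_set (Set.uIcc_subset_uIcc_right hxu))
  linarith

/-- The Gagliardo–Nirenberg inequality on the half-line. -/
theorem sq_zero_le (h : HasH1DerivOn (Set.Ici 0) u u') :
    u 0 ^ 2 ≤ 2 * √((∫ x in Set.Ici (0 : ℝ), u x ^ 2) * ∫ x in Set.Ici (0 : ℝ), u' x ^ 2) := by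
  set m := ∫ x in Set.Ici (0 : ℝ), u x ^ 2
  set k := ∫ x in Set.Ici (0 : ℝ), u' x ^ 2
  by_contra! hlt
  -- If the bound failed, `u ^ 2` would stay above a fixed positive constant on the half-line, and a
  -- long enough interval would hold more than the whole mass.
  obtain ⟨R, hR, hRm⟩ : ∃ R : ℝ, 0 < R ∧ m < R * (u 0 ^ 2 - 2 * √(m * k)) := by
    have hd : 0 < u 0 ^ 2 - 2 * √(m * k) := sub_pos.2 hlt
    refine ⟨(|m| + 1) / (u 0 ^ 2 - 2 * √(m * k)), by positivity, ?_⟩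
    rw [div_mul_cancel₀ _ hd.ne']
    linarith [le_abs_self m]
  have h1 : ∫ x in Set.Icc 0 R, (u 0 ^ 2 - 2 * √(m * k)) ≤ ∫ x in Set.Icc 0 R, u x ^ 2 := by
    refine setIntegral_mono_on (by simp) (h.integrableOn_sq.mono_set Set.Icc_subset_Ici_self)
      measurableSet_Icc fun x hx => ?_
    have := h.sq_le_sq_add hx.1 le_rfl Set.Icc_subset_Ici_self
      Set.Icc_subset_Ici_self
    linarith
  have h2 : ∫ x in Set.Icc 0 R, u x ^ 2 ≤ m :=
    setIntegral_mono_set h.integrableOn_sq (.of_forall fun x => sq_nonneg _)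
      (LE.le.eventuallyLE Set.Icc_subset_Ici_self)
  simp [hR.le] at h1
  linarith

theorem continuousOn {l : ℝ} (h : HasH1DerivOn (Set.Icc 0 l) u u') (hl : 0 ≤ l) :
    ContinuousOn u (Set.Icc 0 l) := by
  have hint := h.intervalIntegrable_deriv hl le_rfl
  have := hint.absolutelyContinuousOnInterval_intervalIntegral (c := 0) (by simp)
  have hc := this.continuousOn
  rw [Set.uIcc_of_le hl] at hc
  exact (continuousOn_const.add hc).congr h.eq_integral

/-- The `L⁶` norm is controlled by the mass and a uniform bound. -/
theorem integral_six_le {l s : ℝ} (h : HasH1DerivOn (Set.Icc 0 l) u u') (hl : 0 ≤ l)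
    (hs : ∀ x ∈ Set.Icc 0 l, u x ^ 2 ≤ s) :
    ∫ x in Set.Icc 0 l, |u x| ^ 6 ≤ s ^ 2 * ∫ x in Set.Icc 0 l, u x ^ 2 := by
  rw [← integral_const_mul]
  refine setIntegral_mono_on ?_ (h.integrableOn_sq.const_mul _) measurableSet_Icc fun x hx => ?_
  · exact ((h.continuousOn hl).abs.pow 6).integrableOn_Icc
  · have h6 : |u x| ^ 6 = (u x ^ 2) ^ 2 * u x ^ 2 := by
      rw [show |u x| ^ 6 = (|u x| ^ 2) ^ 3 by ring, sq_abs]; ring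
    rw [h6]
    gcongr
    exact hs x hx

end MetricGraph.HasH1DerivOn

/-! ### Masses, energies and quotients on a graph -/

namespace MetricGraph

variable {G : MetricGraph}

/-- The mass of the restriction to a bounded edge. -/
noncomputable def edgeMass (u : G.H1) (e : G.E) : ℝ := ∫ x in Set.Icc 0 (G.len e), u.onE e x ^ 2

/-- The kinetic energy of the restriction to a bounded edge. -/
noncomputable def edgeKinetic (u : G.H1) (e : G.E) : ℝ :=
  ∫ x in Set.Icc 0 (G.len e), u.onE' e x ^ 2

/-- The mass of the restriction to a half-line. -/
noncomputable def rayMass (u : G.H1) (h : G.H) : ℝ := ∫ x in Set.Ici (0 : ℝ), u.onH h x ^ 2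

/-- The kinetic energy of the restriction to a half-line. -/
noncomputable def rayKinetic (u : G.H1) (h : G.H) : ℝ := ∫ x in Set.Ici (0 : ℝ), u.onH' h x ^ 2

theorem edgeMass_nonneg (u : G.H1) (e : G.E) : 0 ≤ edgeMass u e :=
  integral_nonneg fun _ => sq_nonneg _

theorem edgeKinetic_nonneg (u : G.H1) (e : G.E) : 0 ≤ edgeKinetic u e :=
  integral_nonneg fun _ => sq_nonneg _

theorem rayMass_nonneg (u : G.H1) (h : G.H) : 0 ≤ rayMass u h :=
  integral_nonneg fun _ => sq_nonneg _

theorem rayKinetic_nonneg (u : G.H1) (h : G.H) : 0 ≤ rayKinetic u h :=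
  integral_nonneg fun _ => sq_nonneg _

theorem mass_nonneg (u : G.H1) : 0 ≤ mass u :=
  add_nonneg (Finset.sum_nonneg fun e _ => edgeMass_nonneg u e)
    (Finset.sum_nonneg fun h _ => rayMass_nonneg u h)

theorem kinetic_nonneg (u : G.H1) : 0 ≤ kinetic u :=
  add_nonneg (Finset.sum_nonneg fun e _ => edgeKinetic_nonneg u e)
    (Finset.sum_nonneg fun h _ => rayKinetic_nonneg u h)

theorem edgeMass_le_mass (u : G.H1) (e : G.E) : edgeMass u e ≤ mass u :=
  (Finset.single_le_sum (fun e _ => edgeMass_nonneg u e) (Finset.mem_univ e)).trans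
    (le_add_of_nonneg_right (Finset.sum_nonneg fun h _ => rayMass_nonneg u h))

theorem edgeKinetic_le_kinetic (u : G.H1) (e : G.E) : edgeKinetic u e ≤ kinetic u :=
  (Finset.single_le_sum (fun e _ => edgeKinetic_nonneg u e) (Finset.mem_univ e)).trans
    (le_add_of_nonneg_right (Finset.sum_nonneg fun h _ => rayKinetic_nonneg u h))

theorem rayMass_le_mass (u : G.H1) (h : G.H) : rayMass u h ≤ mass u :=
  (Finset.single_le_sum (fun h _ => rayMass_nonneg u h) (Finset.mem_univ h)).trans
    (le_add_of_nonneg_left (Finset.sum_nonneg fun e _ => edgeMass_nonneg u e))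

theorem rayKinetic_le_kinetic (u : G.H1) (h : G.H) : rayKinetic u h ≤ kinetic u :=
  (Finset.single_le_sum (fun h _ => rayKinetic_nonneg u h) (Finset.mem_univ h)).trans
    (le_add_of_nonneg_left (Finset.sum_nonneg fun e _ => edgeKinetic_nonneg u e))

theorem sum_edgeMass_le_mass (u : G.H1) : ∑ e, edgeMass u e ≤ mass u :=
  le_add_of_nonneg_right (Finset.sum_nonneg fun h _ => rayMass_nonneg u h)

theorem coreSix_le (u : G.H1) {s : G.E → ℝ}
    (hs : ∀ e, ∀ x ∈ Set.Icc 0 (G.len e), u.onE e x ^ 2 ≤ s e) :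
    coreSix u ≤ ∑ e, s e ^ 2 * edgeMass u e :=
  Finset.sum_le_sum fun e _ => (u.h1_onE e).integral_six_le (G.len_pos e).le (hs e)

/-- The square of the value at the origin of a half-line. -/
theorem sq_val_origin_le (u : G.H1) (h : G.H) :
    u.val (G.origin h) ^ 2 ≤ 2 * √(rayMass u h * rayKinetic u h) := by
  rw [← u.onH_origin]
  exact (u.h1_onH h).sq_zero_le

/-- The product form needs no positivity of the denominator: where it vanishes the quotient is `0`
by convention, and `0 ≤ C`. -/
theorem mem_upperBounds_quotients {C : ℝ} (hC : 0 ≤ C)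
    (h : ∀ u : G.H1, coreSix u ≤ C * (mass u ^ 2 * kinetic u)) : C ∈ upperBounds G.quotients := by
  rintro q ⟨u, -, rfl⟩
  exact div_le_of_le_mul₀ (mul_nonneg (sq_nonneg _) (kinetic_nonneg u)) hC (h u)

theorem reducedCriticalMass_le (hb : BddAbove G.quotients) {q : ℝ} (hq : q ∈ G.quotients)
    (hq0 : 0 < q) : G.reducedCriticalMass ≤ √(3 / q) :=
  Real.sqrt_le_sqrt (div_le_div_of_nonneg_left (by norm_num) hq0 (le_csSup hb hq))

/-- A positive quotient is required because a zero supremum would make `3 / 0 = 0`, and the reduced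
critical mass would be `0`. -/
theorem le_reducedCriticalMass {C q : ℝ} (hC : C ∈ upperBounds G.quotients) (hq : q ∈ G.quotients)
    (hq0 : 0 < q) : √(3 / C) ≤ G.reducedCriticalMass :=
  Real.sqrt_le_sqrt (div_le_div_of_nonneg_left (by norm_num)
    (hq0.trans_le (le_csSup ⟨C, hC⟩ hq)) (csSup_le ⟨q, hq⟩ hC))

/-- A continuously differentiable function which is square integrable together with its derivative
is an `H¹` function. -/
theorem HasH1DerivOn.of_hasDerivAt {I : Set ℝ} {u u' : ℝ → ℝ}
    (hd : ∀ x, HasDerivAt u (u' x) x) (hc : Continuous u')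
    (hu : IntegrableOn (fun x => u x ^ 2) I) (hu' : IntegrableOn (fun x => u' x ^ 2) I) :
    HasH1DerivOn I u u' where
  memLp := (memLp_two_iff_integrable_sq
    (continuous_iff_continuousAt.2 fun x => (hd x).continuousAt).aestronglyMeasurable).2 hu
  memLp_deriv := (memLp_two_iff_integrable_sq hc.aestronglyMeasurable).2 hu'
  eq_integral x _ := by
    rw [intervalIntegral.integral_eq_sub_of_hasDerivAt (fun y _ => hd y)
      (hc.intervalIntegrable _ _)]
    ring

theorem HasH1DerivOn.of_hasDerivAt_Icc {l : ℝ} {u u' : ℝ → ℝ}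
    (hd : ∀ x, HasDerivAt u (u' x) x) (hc : Continuous u') : HasH1DerivOn (Set.Icc 0 l) u u' :=
  .of_hasDerivAt hd hc
    (((continuous_iff_continuousAt.2 fun x => (hd x).continuousAt).pow 2).integrableOn_Icc)
    (hc.pow 2).integrableOn_Icc

/-! ### A rose with many petals -/

/-- The rose: `N` loops of length one and a half-line, attached to a single vertex. -/
def rose (N : ℕ) : MetricGraph where
  V := Unit
  E := Fin N
  H := Unit
  fintypeE := inferInstance
  fintypeH := inferInstance
  src _ := ()
  tgt _ := ()
  len _ := 1
  len_pos _ := one_pos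
  origin _ := ()

theorem rose_oneHalfLineNoTerminal {N : ℕ} (hN : 0 < N) : (rose N).OneHalfLineNoTerminal := by
  have hdeg : ∀ v, (rose N).degree v ≠ 1 := by
    intro v
    have h1 : Nat.card {e : (rose N).E // (rose N).src e = v} = N :=
      (Nat.card_congr (Equiv.subtypeUnivEquiv (p := fun e => (rose N).src e = v) fun _ => rfl)).trans
        (Nat.card_fin N)
    have h2 : Nat.card {h : (rose N).H // (rose N).origin h = v} = 1 :=
      (Nat.card_congr (Equiv.subtypeUnivEquiv
        (p := fun h => (rose N).origin h = v) fun _ => rfl)).trans (Nat.card_unique (α := Unit))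
    rw [degree, h1, h2]
    omega
  exact
    { admissible :=
        { connected := ⟨⟨()⟩, fun v w => Relation.ReflTransGen.refl⟩
          noncompact := ⟨()⟩
          core_nonempty := ⟨(⟨0, hN⟩ : Fin N)⟩ }
      oneHalfLine := Nat.card_unique (α := Unit)
      noTerminalEdge := ⟨fun _ => ⟨hdeg _, hdeg _⟩, fun _ => hdeg _⟩ }

theorem rose_coreLength (N : ℕ) : (rose N).coreLength = N := by
  change ∑ _e : Fin N, (1 : ℝ) = N
  simp

/-- Every point is within `1` of the vertex along its petal; the path through coordinate `0` need
not be shortest. -/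
theorem rose_coreDiam_le (N : ℕ) : (rose N).coreDiam ≤ 2 := by
  refine iSup₂_le fun p hp => iSup₂_le fun q hq => ?_
  obtain ⟨e, s⟩ := p
  obtain ⟨f, t⟩ := q
  have hs : s ∈ Set.Icc (0 : ℝ) 1 := hp
  have ht : t ∈ Set.Icc (0 : ℝ) 1 := hq
  have h0 : (0 : ℝ) ∈ Set.Icc (0 : ℝ) 1 := by simp
  have path : (rose N).CorePath (e, s) (f, t) (|s - 0| + (0 + |0 - t|)) :=
    .trans _ (e, 0) _ _ _ (.segment e s 0 hs h0)
      (.trans _ (f, 0) _ _ _ (.glue _ _ () (.inl ⟨rfl, rfl⟩) (.inl ⟨rfl, rfl⟩))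
        (.segment f 0 t h0 ht))
  refine (iInf₂_le _ path).trans (ENNReal.ofReal_le_of_le_toReal ?_)
  rw [sub_zero, zero_sub, abs_neg, abs_of_nonneg hs.1, abs_of_nonneg ht.1]
  simp only [ENNReal.toReal_ofNat]
  linarith [hs.2, ht.2]

/-- The value at the vertex of the rose is controlled by the mean over the petals. -/
theorem rose_vertex_bound {N : ℕ} (u : (rose N).H1) (e : (rose N).E) :
    u.val () ^ 2 ≤ edgeMass u e + √(edgeMass u e * edgeKinetic u e) := by
  have h := u.h1_onE e
  have hl : u.onE e ((rose N).len e) = u.onE e 0 := by rw [u.onE_src, u.onE_tgt]; rfl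
  have h1 : ∫ x in Set.Icc 0 ((rose N).len e),
      (u.val () ^ 2 - √(edgeMass u e * edgeKinetic u e)) ≤ edgeMass u e := by
    refine setIntegral_mono_on (by simp) h.integrableOn_sq measurableSet_Icc fun x hx => ?_
    have h2 := (abs_le.1 (h.abs_sq_sub_sq_le_of_loop hl hx)).1
    rw [u.onE_src] at h2
    change -√(edgeMass u e * edgeKinetic u e) ≤ u.onE e x ^ 2 - u.val () ^ 2 at h2
    linarith
  have h3 : (rose N).len e = 1 := rfl
  simp [h3] at h1
  linarith

theorem rose_petal_bound {N : ℕ} (u : (rose N).H1) (e : (rose N).E) {x : ℝ}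
    (hx : x ∈ Set.Icc 0 ((rose N).len e)) :
    u.onE e x ^ 2 ≤ u.val () ^ 2 + √(edgeMass u e * edgeKinetic u e) := by
  have hl : u.onE e ((rose N).len e) = u.onE e 0 := by rw [u.onE_src, u.onE_tgt]; rfl
  have h2 := (abs_le.1 ((u.h1_onE e).abs_sq_sub_sq_le_of_loop hl hx)).2
  rw [u.onE_src] at h2
  change u.onE e x ^ 2 - u.val () ^ 2 ≤ √(edgeMass u e * edgeKinetic u e) at h2
  linarith

/-- `rose_petal_bound` integrated over a petal of length one. It limits the share of the mass on a
single petal. -/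
theorem rose_edgeMass_le {N : ℕ} (u : (rose N).H1) (e : (rose N).E) :
    edgeMass u e ≤ u.val () ^ 2 + √(edgeMass u e * edgeKinetic u e) := by
  have h1 : edgeMass u e ≤ ∫ x in Set.Icc 0 ((rose N).len e),
      (u.val () ^ 2 + √(edgeMass u e * edgeKinetic u e)) :=
    setIntegral_mono_on (u.h1_onE e).integrableOn_sq (by simp) measurableSet_Icc
      fun x hx => rose_petal_bound u e hx
  have h3 : (rose N).len e = 1 := rfl
  simpa [h3] using h1

/-- The finite-dimensional inequality behind the estimate on the rose: `c` is the squared value at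
the vertex, `m`, `k` are the masses and kinetic energies of the petals, `a`, `b` those of the
half-line. -/
theorem rose_inequality {ι : Type*} [Fintype ι] {m k : ι → ℝ} {a b c δ η : ℝ}
    (hm : ∀ i, 0 ≤ m i) (hk : ∀ i, 0 ≤ k i) (ha : 0 ≤ a) (hb : 0 ≤ b) (hc : 0 ≤ c)
    (hδ : 0 < δ) (hη : 0 < η) (hN : 2 ≤ Fintype.card ι * δ)
    (hNη : 1 / Fintype.card ι + 2 / (Fintype.card ι * δ - 1) ≤ η)
    (hray : c ≤ 2 * √(a * b)) (hvertex : ∀ i, c ≤ m i + √(m i * k i))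
    (hmass : ∀ i, m i ≤ c + √(m i * k i)) :
    ∑ i, (c + √(m i * k i)) ^ 2 * m i ≤
      max ((1 + δ) ^ 2) (1 + η) * ((∑ i, m i + a) ^ 2 * (∑ i, k i + b)) := by
  set M := ∑ i, m i with hM
  set K := ∑ i, k i with hK
  set n : ℝ := (Fintype.card ι : ℝ) with hn
  have hM0 : 0 ≤ M := Finset.sum_nonneg fun i _ => hm i
  have hK0 : 0 ≤ K := Finset.sum_nonneg fun i _ => hk i
  have hmM : ∀ i, m i ≤ M := fun i => Finset.single_le_sum (fun i _ => hm i) (Finset.mem_univ i)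
  have hkK : ∀ i, k i ≤ K := fun i => Finset.single_le_sum (fun i _ => hk i) (Finset.mem_univ i)
  have hmk : ∀ i, √(m i * k i) ≤ √(M * K) := fun i =>
    Real.sqrt_le_sqrt (mul_le_mul (hmM i) (hkK i) (hk i) hM0)
  have hsq : √(M * K) ^ 2 = M * K := Real.sq_sqrt (mul_nonneg hM0 hK0)
  have hS0 := Real.sqrt_nonneg (M * K)
  have htot : 0 ≤ (M + a) ^ 2 * (K + b) := by positivity
  -- For small `c`, every petal has `u ^ 2 ≤ (1 + δ) * √(M * K)`, which gives the constant `(1 + δ)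
  -- ^ 2`.
  rcases le_or_gt c (δ * √(M * K)) with hcase | hcase
  · have h1 : ∑ i, (c + √(m i * k i)) ^ 2 * m i ≤ ∑ i, ((1 + δ) ^ 2 * (M * K)) * m i := by
      refine Finset.sum_le_sum fun i _ => mul_le_mul_of_nonneg_right ?_ (hm i)
      rw [← hsq, ← mul_pow]
      refine pow_le_pow_left₀ (by positivity) ?_ 2
      linarith [hmk i]
    rw [← Finset.mul_sum, ← hM] at h1
    have h2 : M * K * M ≤ (M + a) ^ 2 * (K + b) := by
      rw [show M * K * M = M ^ 2 * K by ring]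
      gcongr <;> linarith
    calc _ ≤ (1 + δ) ^ 2 * (M * K) * M := h1
      _ = (1 + δ) ^ 2 * (M * K * M) := by ring
      _ ≤ (1 + δ) ^ 2 * ((M + a) ^ 2 * (K + b)) := by gcongr
      _ ≤ _ := mul_le_mul_of_nonneg_right (le_max_left _ _) htot
  · have hsum_sqrt : ∑ i, √(m i * k i) ≤ √(M * K) := by
      simp_rw [Real.sqrt_mul (hm _), Real.sqrt_mul hM0]
      exact Real.sum_sqrt_mul_sqrt_le _ hm hk
    -- Summing the vertex bound over all petals is where their number enters.
    have hnc : n * c ≤ M + √(M * K) := by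
      have := Finset.sum_le_sum fun i (_ : i ∈ Finset.univ) => hvertex i
      rw [Finset.sum_add_distrib] at this
      simp only [Finset.sum_const, Finset.card_univ, nsmul_eq_mul] at this
      linarith
    have hn0 : 0 < n := by
      by_contra! h
      nlinarith
    have hd : 1 ≤ n * δ - 1 := by linarith
    -- `hcase` multiplied by `n` is compared with `hnc`: for large `n`, both `√(M * K)` and `c` are
    -- small relative to `M`.
    have hS : √(M * K) * (n * δ - 1) ≤ M := by nlinarith
    have hS' : √(M * K) ≤ M / (n * δ - 1) := (le_div_iff₀ (by linarith)).2 hS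
    have hSM : √(M * K) ≤ M := by nlinarith
    have hc' : c ≤ M / n + M / (n * δ - 1) := by
      have h1 : √(M * K) / n ≤ √(M * K) := div_le_self hS0 (by
        rw [hn] at hn0 ⊢
        exact_mod_cast hn0)
      have h2 : c ≤ (M + √(M * K)) / n := (le_div_iff₀ hn0).2 (by linarith)
      rw [add_div] at h2
      linarith
    have hmη : ∀ i, m i ≤ η * M := by
      intro i
      have h1 : M / n + M / (n * δ - 1) + M / (n * δ - 1) =
        (1 / n + 2 / (n * δ - 1)) * M := by ring
      have h2 := mul_le_mul_of_nonneg_right hNη hM0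
      linarith [hmass i, hmk i]
    -- With `c ≤ 2 * √(a * b)`, this is Cauchy–Schwarz for the vectors `(2√a, √m)` and `(√b, √k)`.
    have hterm : ∀ i, (c + √(m i * k i)) ^ 2 ≤ (4 * a + m i) * (K + b) := by
      intro i
      have h1 : √(a * b) ^ 2 = a * b := Real.sq_sqrt (mul_nonneg ha hb)
      have h2 : √(m i * k i) ^ 2 = m i * k i := Real.sq_sqrt (mul_nonneg (hm i) (hk i))
      have h4 : 4 * (√(a * b) * √(m i * k i)) ≤ 4 * a * k i + m i * b := by
        have e1 : (√(a * b) * √(m i * k i)) = √(a * k i) * √(m i * b) := by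
          rw [← Real.sqrt_mul (mul_nonneg ha hb), ← Real.sqrt_mul (mul_nonneg ha (hk i))]
          congr 1; ring
        have e2 := two_mul_le_add_sq (2 * √(a * k i)) (√(m i * b))
        rw [mul_pow, Real.sq_sqrt (mul_nonneg ha (hk i)), Real.sq_sqrt (mul_nonneg (hm i) hb)] at e2
        linarith
      calc (c + √(m i * k i)) ^ 2 ≤ (2 * √(a * b) + √(m i * k i)) ^ 2 := by gcongr
        _ = 4 * (a * b) + 4 * (√(a * b) * √(m i * k i)) + m i * k i := by
          linear_combination 4 * h1 + h2
        _ ≤ (4 * a + m i) * (k i + b) := by linarith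
        _ ≤ _ := by
          have := hm i
          gcongr
          exact hkK i
    have h1 : ∑ i, (c + √(m i * k i)) ^ 2 * m i ≤ ∑ i, ((4 * a + η * M) * (K + b)) * m i := by
      refine Finset.sum_le_sum fun i _ => mul_le_mul_of_nonneg_right ((hterm i).trans ?_) (hm i)
      gcongr
      exact hmη i
    rw [← Finset.mul_sum, ← hM] at h1
    calc _ ≤ (4 * a + η * M) * (K + b) * M := h1
      _ = (4 * a * M + η * M ^ 2) * (K + b) := by ring
      -- The constant `4` from the half-line is exactly absorbed by `4 * a * M ≤ (M + a) ^ 2`.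
      _ ≤ ((1 + η) * (M + a) ^ 2) * (K + b) := by
        gcongr
        have : M ^ 2 ≤ (M + a) ^ 2 := by gcongr; linarith
        nlinarith [sq_nonneg (M - a)]
      _ = (1 + η) * ((M + a) ^ 2 * (K + b)) := by ring
      _ ≤ _ := mul_le_mul_of_nonneg_right (le_max_right _ _) htot

theorem rose_coreSix_le {N : ℕ} {δ η : ℝ} (hδ : 0 < δ) (hη : 0 < η) (hN : 2 ≤ N * δ)
    (hNη : 1 / N + 2 / (N * δ - 1) ≤ η) (u : (rose N).H1) :
    coreSix u ≤ max ((1 + δ) ^ 2) (1 + η) * (mass u ^ 2 * kinetic u) := by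
  have hcard : Fintype.card (rose N).E = N := Fintype.card_fin N
  have hm : mass u = ∑ e, edgeMass u e + rayMass u () :=
    congrArg _ (Fintype.sum_unique (ι := Unit) _)
  have hk : kinetic u = ∑ e, edgeKinetic u e + rayKinetic u () :=
    congrArg _ (Fintype.sum_unique (ι := Unit) _)
  rw [hm, hk]
  refine (coreSix_le u fun e x hx => rose_petal_bound u e hx).trans ?_
  exact rose_inequality (edgeMass_nonneg u) (edgeKinetic_nonneg u) (rayMass_nonneg u ())
    (rayKinetic_nonneg u ()) (sq_nonneg _) hδ hη (by rwa [hcard]) (by rwa [hcard])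
    (sq_val_origin_le u ()) (rose_vertex_bound u) (rose_edgeMass_le u)

/-- The function on the rose which is `x (1 - x)` on each petal and vanishes on the half-line. -/
noncomputable def roseBump (N : ℕ) : (rose N).H1 where
  onE _ x := x * (1 - x)
  onE' _ x := 1 - 2 * x
  onH _ _ := 0
  onH' _ _ := 0
  val _ := 0
  h1_onE e := .of_hasDerivAt_Icc
    (fun x => ((hasDerivAt_id x).mul ((hasDerivAt_id x).const_sub 1)).congr_deriv
      (by simp only [id]; ring)) (by fun_prop)
  h1_onH h := .of_hasDerivAt (fun x => hasDerivAt_const x 0) continuous_const (by simp) (by simp)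
  onE_src e := by simp
  onE_tgt e := by change (1 : ℝ) * (1 - 1) = 0; simp
  onH_origin h := rfl

/-- Supplies the positive quotient needed by `le_reducedCriticalMass`. -/
theorem rose_exists_pos_quotient {N : ℕ} (hN : 0 < N) : ∃ q ∈ (rose N).quotients, 0 < q := by
  have hne : (Finset.univ : Finset (rose N).E).Nonempty := ⟨(⟨0, hN⟩ : Fin N), Finset.mem_univ _⟩
  have hpos : ∀ n : ℕ, 0 < ∫ x in Set.Icc (0 : ℝ) 1, |x * (1 - x)| ^ n := fun n => by
    rw [integral_Icc_eq_integral_Ioc, ← intervalIntegral.integral_of_le zero_le_one]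
    refine intervalIntegral.intervalIntegral_pos_of_pos_on
      (Continuous.intervalIntegrable (by fun_prop) _ _) (fun x hx => ?_) one_pos
    have : 0 < x * (1 - x) := mul_pos hx.1 (sub_pos.2 hx.2)
    positivity
  have hm : ∀ e, 0 < edgeMass (roseBump N) e := fun e => by
    have := hpos 2
    simp only [sq_abs] at this
    exact this
  -- The bump vanishes at the vertex, so its mass on a petal is at most `√(m * k)`; positive mass
  -- then forces `k > 0`.
  have hk : ∀ e, 0 < edgeKinetic (roseBump N) e := fun e => by
    have h1 := rose_edgeMass_le (roseBump N) e
    have h2 : (roseBump N).val () = 0 := rfl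
    rw [h2, zero_pow two_ne_zero, zero_add] at h1
    exact pos_of_mul_pos_right (Real.sqrt_pos.1 ((hm e).trans_le h1)) (hm e).le
  have hmass : 0 < mass (roseBump N) :=
    (Finset.sum_pos (fun e _ => hm e) hne).trans_le (sum_edgeMass_le_mass _)
  have hkin : 0 < kinetic (roseBump N) :=
    (hk (⟨0, hN⟩ : Fin N)).trans_le (edgeKinetic_le_kinetic _ _)
  have hsix : 0 < coreSix (roseBump N) := Finset.sum_pos (fun e _ => hpos 6) hne
  exact ⟨_, ⟨roseBump N, hmass.ne', rfl⟩, by positivity⟩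

theorem exists_rose (ε : ℝ) (hε : 0 < ε) (L : ℝ) : ∃ N : ℕ, 0 < N ∧ L ≤ N ∧
    BddAbove (rose N).quotients ∧ √3 - ε ≤ (rose N).reducedCriticalMass := by
  obtain ⟨δ, hδ, hδε⟩ : ∃ δ : ℝ, 0 < δ ∧ √3 - ε ≤ √(3 / (1 + δ) ^ 2) := by
    have hc : ContinuousAt (fun δ : ℝ => √(3 / (1 + δ) ^ 2)) 0 := by
      refine ContinuousAt.sqrt (ContinuousAt.div₀ (by fun_prop) (by fun_prop) (by norm_num))
    have h0 : √3 - ε < √(3 / (1 + (0 : ℝ)) ^ 2) := by simpa using hε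
    have := (hc.eventually (lt_mem_nhds h0)).filter_mono (nhdsWithin_le_nhds (s := Set.Ioi 0))
    obtain ⟨δ, h1, h2⟩ := (this.and self_mem_nhdsWithin).exists
    exact ⟨δ, h2, h1.le⟩
  have hlim : Filter.Tendsto (fun N : ℕ => 1 / (N : ℝ) + 2 / (N * δ - 1)) Filter.atTop
      (nhds (0 + 0)) := by
    refine tendsto_one_div_atTop_nhds_zero_nat.add (tendsto_const_nhds.div_atTop ?_)
    exact Filter.tendsto_atTop_add_const_right _ (-1)
      (tendsto_natCast_atTop_atTop.atTop_mul_const hδ)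
  rw [add_zero] at hlim
  obtain ⟨N, hN1, hN2, hN3, hN4⟩ := ((hlim.eventually (gt_mem_nhds hδ)).and
    ((tendsto_natCast_atTop_atTop.eventually_ge_atTop L).and
    (((tendsto_natCast_atTop_atTop.atTop_mul_const hδ).eventually_ge_atTop 2).and
    (Filter.eventually_gt_atTop 0)))).exists
  have hC : (1 + δ) ^ 2 ∈ upperBounds (rose N).quotients := by
    refine mem_upperBounds_quotients (by positivity) fun u => ?_
    -- With `η = δ` the maximum is `(1 + δ) ^ 2`, since `1 + δ ≤ (1 + δ) ^ 2`.
    have := rose_coreSix_le hδ hδ hN3 hN1.le u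
    rwa [max_eq_left (by nlinarith)] at this
  obtain ⟨q, hq, hq0⟩ := rose_exists_pos_quotient hN4
  exact ⟨N, hN4, hN2, ⟨_, hC⟩, hδε.trans (le_reducedCriticalMass hC hq hq0)⟩

end MetricGraph

/-! ### The soliton of the half-line -/

/-- The (rescaled) quintic soliton `1 / √(cosh x)`. -/
noncomputable def soliton (x : ℝ) : ℝ := (√(Real.cosh x))⁻¹

/-- The derivative of the soliton. -/
noncomputable def solitonDeriv (x : ℝ) : ℝ :=
  -(Real.sinh x / (2 * √(Real.cosh x))) / √(Real.cosh x) ^ 2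

theorem hasDerivAt_soliton (x : ℝ) : HasDerivAt soliton (solitonDeriv x) x :=
  ((Real.hasDerivAt_cosh x).sqrt (Real.cosh_pos x).ne').inv
    (Real.sqrt_pos.2 (Real.cosh_pos x)).ne'

theorem continuous_solitonDeriv : Continuous solitonDeriv := by
  have h : ∀ x, √(Real.cosh x) ≠ 0 := fun x => (Real.sqrt_pos.2 (Real.cosh_pos x)).ne'
  have hc : Continuous fun x => √(Real.cosh x) := Real.continuous_cosh.sqrt
  exact ((Real.continuous_sinh.div (continuous_const.mul hc) fun x =>
    mul_ne_zero two_ne_zero (h x)).neg).div (hc.pow 2) fun x => pow_ne_zero 2 (h x)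

theorem soliton_sq (x : ℝ) : soliton x ^ 2 = (Real.cosh x)⁻¹ := by
  rw [soliton, inv_pow, Real.sq_sqrt (Real.cosh_pos x).le]

theorem abs_soliton_pow_six (x : ℝ) : |soliton x| ^ 6 = (Real.cosh x ^ 3)⁻¹ := by
  rw [show |soliton x| ^ 6 = (|soliton x| ^ 2) ^ 3 by ring, sq_abs, soliton_sq, inv_pow]

/-- By `sinh ^ 2 = cosh ^ 2 - 1`, the kinetic energy needs no integrals beyond those of `1 / cosh`
and `1 / cosh ^ 3`. -/
theorem solitonDeriv_sq (x : ℝ) :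
    solitonDeriv x ^ 2 = ((Real.cosh x)⁻¹ - (Real.cosh x ^ 3)⁻¹) / 4 := by
  have h := Real.cosh_pos x
  rw [solitonDeriv, Real.sq_sqrt h.le, div_pow, neg_sq, div_pow, mul_pow, Real.sq_sqrt h.le,
    Real.sinh_sq]
  field_simp
  norm_num

/-- A primitive of `1 / cosh`. -/
noncomputable def sechPrimitive (x : ℝ) : ℝ := Real.arctan (Real.sinh x)

/-- A primitive of `1 / cosh³`. -/
noncomputable def sechCubePrimitive (x : ℝ) : ℝ :=
  (Real.sinh x / Real.cosh x ^ 2 + Real.arctan (Real.sinh x)) / 2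

theorem hasDerivAt_sechPrimitive (x : ℝ) : HasDerivAt sechPrimitive (Real.cosh x)⁻¹ x := by
  refine (Real.hasDerivAt_sinh x).arctan.congr_deriv ?_
  have h := Real.cosh_pos x
  rw [add_comm, ← Real.cosh_sq]
  field_simp

theorem hasDerivAt_sechCubePrimitive (x : ℝ) :
    HasDerivAt sechCubePrimitive (Real.cosh x ^ 3)⁻¹ x := by
  have h := Real.cosh_pos x
  refine ((((Real.hasDerivAt_sinh x).div ((Real.hasDerivAt_cosh x).pow 2)
    (pow_pos h 2).ne').add (Real.hasDerivAt_sinh x).arctan).div_const 2).congr_deriv ?_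
  rw [add_comm 1 (Real.sinh x ^ 2), ← Real.cosh_sq]
  have hs := Real.sinh_sq x
  simp only [Pi.pow_apply]
  field_simp
  push_cast
  linear_combination (-2 * Real.cosh x) * hs

theorem tendsto_cosh_atTop : Filter.Tendsto Real.cosh Filter.atTop Filter.atTop := by
  refine Filter.tendsto_atTop_mono (fun x => ?_)
    (Real.tendsto_exp_atTop.atTop_div_const (r := 2) two_pos)
  rw [Real.cosh_eq]
  linarith [Real.exp_pos (-x)]

theorem tendsto_sechPrimitive :
    Filter.Tendsto sechPrimitive Filter.atTop (nhds (Real.pi / 2)) := by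
  have hs : Filter.Tendsto Real.sinh Filter.atTop Filter.atTop :=
    Real.sinhOrderIso.tendsto_atTop
  exact (tendsto_nhds_of_tendsto_nhdsWithin Real.tendsto_arctan_atTop).comp hs

theorem tendsto_sechCubePrimitive :
    Filter.Tendsto sechCubePrimitive Filter.atTop (nhds (Real.pi / 4)) := by
  have h : Filter.Tendsto (fun x => Real.sinh x / Real.cosh x ^ 2) Filter.atTop (nhds 0) := by
    refine squeeze_zero_norm (fun x => ?_) tendsto_cosh_atTop.inv_tendsto_atTop
    have hc := Real.cosh_pos x
    have hs : |Real.sinh x| ≤ Real.cosh x :=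
      abs_le_of_sq_le_sq (by rw [Real.sinh_sq]; linarith) hc.le
    rw [Real.norm_eq_abs, abs_div, abs_of_pos (pow_pos hc 2), Pi.inv_apply,
      div_le_iff₀ (pow_pos hc 2), sq, inv_mul_cancel_left₀ hc.ne']
    exact hs
  have := (h.add tendsto_sechPrimitive).div_const 2
  rwa [show (0 + Real.pi / 2) / 2 = Real.pi / 4 by ring] at this

/-- The fundamental theorem of calculus on `[0, l]` and on the translated half-line `[l, ∞)`. -/
theorem integral_Icc_add_integral_Ici {F f : ℝ → ℝ} {c l : ℝ} (hl : 0 ≤ l)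
    (hF : ∀ x, HasDerivAt F (f x) x) (hf : Continuous f) (hf0 : ∀ x, 0 ≤ f x)
    (hlim : Filter.Tendsto F Filter.atTop (nhds c)) :
    IntegrableOn (fun x => f (l + x)) (Set.Ici 0) ∧
      (∫ x in Set.Icc 0 l, f x) = F l - F 0 ∧ ∫ x in Set.Ici 0, f (l + x) = c - F l := by
  have hF' : ∀ x ∈ Set.Ici (0 : ℝ), HasDerivAt (fun x => F (l + x)) (f (l + x)) x := fun x _ =>
    (hF (l + x)).comp_const_add l x
  have hlim' : Filter.Tendsto (fun x => F (l + x)) Filter.atTop (nhds c) :=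
    hlim.comp (Filter.tendsto_atTop_add_const_left _ l Filter.tendsto_id)
  have hi := integrableOn_Ioi_deriv_of_nonneg' hF' (fun x _ => hf0 _) hlim'
  refine ⟨(integrableOn_Ici_iff_integrableOn_Ioi (by simp)).2 hi, ?_, ?_⟩
  · rw [integral_Icc_eq_integral_Ioc, ← intervalIntegral.integral_of_le hl,
      intervalIntegral.integral_eq_sub_of_hasDerivAt (fun x _ => hF x)
        (hf.intervalIntegrable _ _)]
  · rw [integral_Ici_eq_integral_Ioi, integral_Ioi_of_hasDerivAt_of_tendsto' hF' hi hlim', add_zero]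

theorem continuous_inv_cosh_pow (n : ℕ) : Continuous fun x => (Real.cosh x ^ n)⁻¹ :=
  (Real.continuous_cosh.pow n).inv₀ fun x => (pow_pos (Real.cosh_pos x) n).ne'

/-- The half-line receives the tail that the handle cuts off, so the two integrals add up to `π / 2`
for every `l`. -/
theorem sech_integrals {l : ℝ} (hl : 0 ≤ l) :
    IntegrableOn (fun x => (Real.cosh (l + x))⁻¹) (Set.Ici 0) ∧
      (∫ x in Set.Icc 0 l, (Real.cosh x)⁻¹) = sechPrimitive l ∧
      ∫ x in Set.Ici 0, (Real.cosh (l + x))⁻¹ = Real.pi / 2 - sechPrimitive l := by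
  have h := integral_Icc_add_integral_Ici hl hasDerivAt_sechPrimitive
    (by simpa using continuous_inv_cosh_pow 1) (fun x => (inv_pos.2 (Real.cosh_pos x)).le)
    tendsto_sechPrimitive
  rwa [show sechPrimitive 0 = 0 by simp [sechPrimitive], sub_zero] at h

theorem sechCube_integrals {l : ℝ} (hl : 0 ≤ l) :
    IntegrableOn (fun x => (Real.cosh (l + x) ^ 3)⁻¹) (Set.Ici 0) ∧
      (∫ x in Set.Icc 0 l, (Real.cosh x ^ 3)⁻¹) = sechCubePrimitive l ∧
      ∫ x in Set.Ici 0, (Real.cosh (l + x) ^ 3)⁻¹ = Real.pi / 4 - sechCubePrimitive l := by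
  have h := integral_Icc_add_integral_Ici hl hasDerivAt_sechCubePrimitive
    (continuous_inv_cosh_pow 3) (fun x => (inv_pos.2 (pow_pos (Real.cosh_pos x) 3)).le)
    tendsto_sechCubePrimitive
  rwa [show sechCubePrimitive 0 = 0 by simp [sechCubePrimitive], sub_zero] at h

namespace MetricGraph

/-! ### A dumbbell with a long handle and short loops -/

/-- The dumbbell: a bridge of length `l` between two vertices, a loop of length `r` at each of
them, and a half-line at the end `false` of the bridge. -/
def dumbbell (l r : ℝ) (hl : 0 < l) (hr : 0 < r) : MetricGraph where
  V := Bool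
  E := Option Bool
  H := Unit
  fintypeE := inferInstance
  fintypeH := inferInstance
  -- `none` is the bridge, with coordinate `0` at `true`; `some v` is the loop at `v`.
  src e := e.getD true
  tgt e := e.getD false
  len e := e.elim l fun _ => r
  len_pos e := by cases e <;> assumption
  origin _ := false

variable {l r : ℝ} {hl : 0 < l} {hr : 0 < r}

/-- The remaining edges are loops, so a path avoiding the bridge never leaves its starting vertex.
-/
theorem dumbbell_isCutEdge : (dumbbell l r hl hr).IsCutEdge (none : Option Bool) := by
  have key : ∀ v : Bool, (dumbbell l r hl hr).JoinedIn {(none : Option Bool)}ᶜ true v →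
      v = true := by
    intro v hv
    induction hv with
    | refl => rfl
    | tail _ h ih =>
      obtain ⟨e, he, h⟩ := h
      match e with
      | none => exact absurd rfl he
      | some w =>
        rcases h with ⟨h1, h2⟩ | ⟨h1, h2⟩
        · exact h2.symm.trans (h1.trans ih)
        · exact h1.symm.trans (h2.trans ih)
  intro h
  exact Bool.false_ne_true (key false h)

theorem dumbbell_oneHalfLineNoTerminal : (dumbbell l r hl hr).OneHalfLineNoTerminal := by
  have hdeg : ∀ v, (dumbbell l r hl hr).degree v ≠ 1 := by
    intro v
    -- The loop at `v` counts both as a source and as a target, so the degree is at least `2`.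
    have h1 : 0 < Nat.card {e // (dumbbell l r hl hr).src e = v} :=
      @Nat.card_pos _ ⟨⟨some v, rfl⟩⟩ (inferInstanceAs (Finite {e : Option Bool // _}))
    have h2 : 0 < Nat.card {e // (dumbbell l r hl hr).tgt e = v} :=
      @Nat.card_pos _ ⟨⟨some v, rfl⟩⟩ (inferInstanceAs (Finite {e : Option Bool // _}))
    rw [degree]
    omega
  have hadj : ∀ v w : Bool, (dumbbell l r hl hr).AdjIn Set.univ v w := by
    rintro (_ | _) (_ | _)
    · exact ⟨some false, trivial, .inl ⟨rfl, rfl⟩⟩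
    · exact ⟨(none : Option Bool), trivial, .inr ⟨rfl, rfl⟩⟩
    · exact ⟨(none : Option Bool), trivial, .inl ⟨rfl, rfl⟩⟩
    · exact ⟨some true, trivial, .inl ⟨rfl, rfl⟩⟩
  exact
    { admissible :=
        { connected := ⟨⟨true⟩, fun v w => Relation.ReflTransGen.single (hadj v w)⟩
          noncompact := ⟨()⟩
          core_nonempty := ⟨(none : Option Bool)⟩ }
      oneHalfLine := Nat.card_unique (α := Unit)
      noTerminalEdge := ⟨fun _ => ⟨hdeg _, hdeg _⟩, fun _ => hdeg _⟩ }

/-- The oscillation of the square of an `H¹` function on an edge, from its source. -/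
theorem sq_onE_le {G : MetricGraph} (u : G.H1) (e : G.E) {x : ℝ}
    (hx : x ∈ Set.Icc 0 (G.len e)) :
    u.onE e x ^ 2 ≤ u.val (G.src e) ^ 2 + 2 * √(mass u * kinetic u) ∧
      u.val (G.src e) ^ 2 ≤ u.val (G.tgt e) ^ 2 + 2 * √(mass u * kinetic u) := by
  have hle : √(edgeMass u e * edgeKinetic u e) ≤ √(mass u * kinetic u) :=
    Real.sqrt_le_sqrt (mul_le_mul (edgeMass_le_mass u e) (edgeKinetic_le_kinetic u e)
      (edgeKinetic_nonneg u e) (mass_nonneg u))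
  have hl := (G.len_pos e).le
  have h1 := (u.h1_onE e).sq_le_sq_add le_rfl hx.1
    (Set.Icc_subset_Icc_right hl) (Set.Icc_subset_Icc_right hx.2)
  have h2 := (u.h1_onE e).sq_le_sq_add hl le_rfl le_rfl (Set.Icc_subset_Icc_right hl)
  rw [u.onE_src] at h1 h2
  rw [u.onE_tgt] at h2
  exact ⟨h1.trans (add_le_add_right (mul_le_mul_of_nonneg_left hle two_pos.le) _),
    h2.trans (add_le_add_right (mul_le_mul_of_nonneg_left hle two_pos.le) _)⟩

/-- Only finiteness matters. With `S = √(mass * kinetic)`, the half-line bounds `u ^ 2` at `false`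
by `2 * S`, crossing the bridge adds `2 * S`, and moving along any edge adds another `2 * S`; the
constant is `6 ^ 2`. -/
theorem dumbbell_bddAbove_quotients : BddAbove (dumbbell l r hl hr).quotients := by
  refine ⟨36, mem_upperBounds_quotients (by norm_num) fun u => ?_⟩
  set S := √(mass u * kinetic u) with hS
  have hS2 : S ^ 2 = mass u * kinetic u :=
    Real.sq_sqrt (mul_nonneg (mass_nonneg u) (kinetic_nonneg u))
  have hS0 : 0 ≤ S := Real.sqrt_nonneg _
  have hfalse : u.val false ^ 2 ≤ 2 * S := by
    refine (sq_val_origin_le u ()).trans ?_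
    gcongr
    exact Real.sqrt_le_sqrt (mul_le_mul (rayMass_le_mass u _) (rayKinetic_le_kinetic u _)
      (rayKinetic_nonneg u _) (mass_nonneg u))
  have htrue : u.val true ^ 2 ≤ 4 * S := by
    have : u.val true ^ 2 ≤ u.val false ^ 2 + 2 * S :=
      (sq_onE_le u (none : Option Bool) (x := 0) ⟨le_rfl, hl.le⟩).2
    linarith
  have hval : ∀ v : Bool, u.val v ^ 2 ≤ 4 * S := by
    rintro (_ | _)
    · linarith
    · exact htrue
  have h6 := coreSix_le u (s := fun _ => 6 * S) fun e x hx => by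
    linarith [(sq_onE_le u e hx).1, hval ((dumbbell l r hl hr).src e)]
  rw [← Finset.mul_sum] at h6
  calc coreSix u ≤ (6 * S) ^ 2 * ∑ e, edgeMass u e := h6
    _ ≤ (6 * S) ^ 2 * mass u := by gcongr; exact sum_edgeMass_le_mass u
    _ = 36 * (mass u ^ 2 * kinetic u) := by rw [mul_pow, hS2]; ring

theorem dumbbell_sum_edges (f : (dumbbell l r hl hr).E → ℝ) :
    ∑ e, f e = f (none : Option Bool) + (f (some true) + f (some false)) :=
  (Fintype.sum_option (α := Bool) f).trans (congrArg _ (Fintype.sum_bool _))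

theorem dumbbell_mass_eq (u : (dumbbell l r hl hr).H1) : mass u =
    edgeMass u (none : Option Bool) + (edgeMass u (some true) + edgeMass u (some false)) +
      rayMass u () :=
  congrArg₂ _ (dumbbell_sum_edges _) (Fintype.sum_unique (ι := Unit) _)

theorem dumbbell_kinetic_eq (u : (dumbbell l r hl hr).H1) : kinetic u =
    edgeKinetic u (none : Option Bool) + (edgeKinetic u (some true) + edgeKinetic u (some false)) +
      rayKinetic u () :=
  congrArg₂ _ (dumbbell_sum_edges _) (Fintype.sum_unique (ι := Unit) _)

/-- The half soliton with its peak at the end of the handle, extended by constants to the loops. -/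
noncomputable def dumbbellSoliton (l r : ℝ) (hl : 0 < l) (hr : 0 < r) :
    (dumbbell l r hl hr).H1 where
  onE e := Option.elim e soliton fun v _ => bif v then soliton 0 else soliton l
  onE' e := Option.elim e solitonDeriv fun _ _ => 0
  onH _ x := soliton (l + x)
  onH' _ x := solitonDeriv (l + x)
  val v := bif v then soliton 0 else soliton l
  h1_onE e := by
    match e with
    | none => exact .of_hasDerivAt_Icc hasDerivAt_soliton continuous_solitonDeriv
    | some v => exact .of_hasDerivAt_Icc (fun x => hasDerivAt_const x _) continuous_const
  h1_onH h := by
    have h1 := (sech_integrals hl.le).1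
    have h3 := (sechCube_integrals hl.le).1
    refine .of_hasDerivAt (fun x => (hasDerivAt_soliton (l + x)).comp_const_add l x)
      (continuous_solitonDeriv.comp (by fun_prop)) ?_ ?_
    · simpa only [soliton_sq] using h1
    · simp only [solitonDeriv_sq]
      exact (h1.sub h3).div_const 4
  onE_src e := by match e with
    | none => rfl
    | some v => rfl
  onE_tgt e := by match e with
    | none => rfl
    | some v => rfl
  onH_origin h := by simp [dumbbell]

theorem dumbbellSoliton_mass :
    mass (dumbbellSoliton l r hl hr) = Real.pi / 2 + r * (1 + (Real.cosh l)⁻¹) := by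
  have h1 : edgeMass (dumbbellSoliton l r hl hr) (none : Option Bool) = sechPrimitive l := by
    rw [← (sech_integrals hl.le).2.1]
    simp only [← soliton_sq]
    rfl
  have h2 : rayMass (dumbbellSoliton l r hl hr) () = Real.pi / 2 - sechPrimitive l := by
    rw [← (sech_integrals hl.le).2.2]
    simp only [← soliton_sq]
    rfl
  have h3 : edgeMass (dumbbellSoliton l r hl hr) (some true) = r := by
    change ∫ x in Set.Icc 0 r, soliton 0 ^ 2 = r
    simp [soliton_sq, hr.le]
  have h4 : edgeMass (dumbbellSoliton l r hl hr) (some false) = r * (Real.cosh l)⁻¹ := by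
    change ∫ x in Set.Icc 0 r, soliton l ^ 2 = _
    simp [soliton_sq, hr.le]
  rw [dumbbell_mass_eq, h1, h3, h4, h2]
  ring

/-- The loops contribute nothing, and the primitives at `l` cancel between handle and half-line,
leaving `(π / 2 - π / 4) / 4`. -/
theorem dumbbellSoliton_kinetic : kinetic (dumbbellSoliton l r hl hr) = Real.pi / 16 := by
  obtain ⟨i1, j1, k1⟩ := sech_integrals hl.le
  obtain ⟨i3, j3, k3⟩ := sechCube_integrals hl.le
  have h1 : edgeKinetic (dumbbellSoliton l r hl hr) (none : Option Bool) =
      (sechPrimitive l - sechCubePrimitive l) / 4 := by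
    change ∫ x in Set.Icc 0 l, solitonDeriv x ^ 2 = _
    simp only [solitonDeriv_sq]
    rw [integral_div, integral_sub _ (continuous_inv_cosh_pow 3).integrableOn_Icc, j1, j3]
    have := (continuous_inv_cosh_pow 1).integrableOn_Icc (μ := volume) (a := 0) (b := l)
    simp only [pow_one] at this
    exact this
  have h2 : rayKinetic (dumbbellSoliton l r hl hr) () =
      ((Real.pi / 2 - sechPrimitive l) - (Real.pi / 4 - sechCubePrimitive l)) / 4 := by
    change ∫ x in Set.Ici 0, solitonDeriv (l + x) ^ 2 = _
    simp only [solitonDeriv_sq]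
    rw [integral_div, integral_sub i1 i3, k1, k3]
  have h3 : ∀ v : Bool, edgeKinetic (dumbbellSoliton l r hl hr) (some v) = 0 := fun v => by
    change ∫ x in Set.Icc 0 r, (0 : ℝ) ^ 2 = 0
    simp
  rw [dumbbell_kinetic_eq, h1, h3, h3, h2]
  ring

/-- The loops may be dropped: the handle alone carries `π / 4` in the limit. -/
theorem le_dumbbellSoliton_coreSix :
    sechCubePrimitive l ≤ coreSix (dumbbellSoliton l r hl hr) := by
  have h : sechCubePrimitive l = ∫ x in Set.Icc 0 ((dumbbell l r hl hr).len (none : Option Bool)),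
      |(dumbbellSoliton l r hl hr).onE (none : Option Bool) x| ^ 6 := by
    rw [← (sechCube_integrals hl.le).2.1]
    simp only [← abs_soliton_pow_six]
    rfl
  rw [h]
  exact Finset.single_le_sum (f := fun e => ∫ x in Set.Icc 0 ((dumbbell l r hl hr).len e),
    |(dumbbellSoliton l r hl hr).onE e x| ^ 6)
    (fun e _ => integral_nonneg fun x => by positivity) (Finset.mem_univ _)

theorem dumbbell_reducedCriticalMass_le (l r : ℝ) (hl : 0 < l) (hr : 0 < r) :
    (dumbbell l r hl hr).reducedCriticalMass ≤
      √(3 / (sechCubePrimitive l / ((Real.pi / 2 + r * 2) ^ 2 * (Real.pi / 16)))) := by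
  have hpi := Real.pi_pos
  have hs : 0 < sechCubePrimitive l := by
    have : 0 < Real.sinh l := Real.sinh_pos_iff.2 hl
    have h2 := Real.cosh_pos l
    have h3 := Real.arctan_pos.2 this
    rw [sechCubePrimitive]
    positivity
  have hc : (Real.cosh l)⁻¹ ≤ 1 := inv_le_one_of_one_le₀ (Real.one_le_cosh l)
  have hc0 : 0 < (Real.cosh l)⁻¹ := inv_pos.2 (Real.cosh_pos l)
  have hm0 : 0 < mass (dumbbellSoliton l r hl hr) := by
    rw [dumbbellSoliton_mass]; positivity
  have hle : sechCubePrimitive l / ((Real.pi / 2 + r * 2) ^ 2 * (Real.pi / 16)) ≤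
      coreSix (dumbbellSoliton l r hl hr) /
        (mass (dumbbellSoliton l r hl hr) ^ 2 * kinetic (dumbbellSoliton l r hl hr)) := by
    rw [dumbbellSoliton_kinetic]
    refine div_le_div₀ (hs.le.trans le_dumbbellSoliton_coreSix) le_dumbbellSoliton_coreSix
      (by positivity) ?_
    gcongr
    rw [dumbbellSoliton_mass]
    gcongr
    linarith
  have hq0 : 0 < sechCubePrimitive l / ((Real.pi / 2 + r * 2) ^ 2 * (Real.pi / 16)) := by
    positivity
  refine (reducedCriticalMass_le dumbbell_bddAbove_quotients ⟨_, hm0.ne', rfl⟩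
    (hq0.trans_le hle)).trans ?_
  exact Real.sqrt_le_sqrt (div_le_div_of_nonneg_left (by norm_num) hq0 hle)

theorem exists_dumbbell (ε : ℝ) (hε : 0 < ε) (ℓ : ℝ) : ∃ (l r : ℝ) (hl : 0 < l) (hr : 0 < r),
    ℓ ≤ l ∧ (dumbbell l r hl hr).reducedCriticalMass ≤ halfLineCriticalMass + ε := by
  have hpi := Real.pi_pos
  -- The choice `r = l⁻¹` makes the loops vanish as the handle grows, leaving a limit in one
  -- parameter.
  have hlim : Filter.Tendsto (fun l : ℝ =>
      √(3 / (sechCubePrimitive l / ((Real.pi / 2 + l⁻¹ * 2) ^ 2 * (Real.pi / 16)))))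
      Filter.atTop (nhds √(3 / (Real.pi / 4 / ((Real.pi / 2 + 0 * 2) ^ 2 * (Real.pi / 16))))) := by
    refine (tendsto_const_nhds.div (tendsto_sechCubePrimitive.div ?_ ?_) ?_).sqrt
    · exact ((tendsto_const_nhds.add (tendsto_inv_atTop_zero.mul_const 2)).pow 2).mul_const _
    · positivity
    · positivity
  have hval : √(3 / (Real.pi / 4 / ((Real.pi / 2 + 0 * 2) ^ 2 * (Real.pi / 16)))) =
      halfLineCriticalMass := by
    rw [halfLineCriticalMass, show 3 / (Real.pi / 4 / ((Real.pi / 2 + 0 * 2) ^ 2 *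
      (Real.pi / 16))) = 3 * (Real.pi / 4) ^ 2 by field_simp; ring,
      Real.sqrt_mul (by norm_num), Real.sqrt_sq (by positivity), mul_div_assoc]
  rw [hval] at hlim
  obtain ⟨l, h1, h2, h3⟩ := ((hlim.eventually (gt_mem_nhds (lt_add_of_pos_right _ hε))).and
    ((Filter.eventually_ge_atTop ℓ).and (Filter.eventually_gt_atTop 0))).exists
  exact ⟨l, l⁻¹, h3, inv_pos.2 h3, h2, (dumbbell_reducedCriticalMass_le _ _ _ _).trans h1.le⟩

end MetricGraph

/-- `BddAbove` expresses `C < ∞`. It carries content because `sSup` of an unbounded set of reals is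
`0`, which would make the reduced critical mass `0`. -/
theorem theorem2 :
    (∀ ε : ℝ, 0 < ε → ∀ ℓ : ℝ, ∃ G : MetricGraph, G.OneHalfLineNoTerminal ∧
      (∃ e : G.E, G.IsCutEdge e ∧ ℓ ≤ G.len e) ∧
      BddAbove G.quotients ∧ G.reducedCriticalMass ≤ halfLineCriticalMass + ε) ∧
    (∃ D : NNReal, ∀ ε : ℝ, 0 < ε → ∀ L : ℝ, ∃ G : MetricGraph, G.OneHalfLineNoTerminal ∧
      G.coreDiam ≤ D ∧ L ≤ G.coreLength ∧
      BddAbove G.quotients ∧ √3 - ε ≤ G.reducedCriticalMass) := by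
  refine ⟨fun ε hε ℓ => ?_, 2, fun ε hε L => ?_⟩
  · obtain ⟨l, r, hl, hr, h1, h2⟩ := MetricGraph.exists_dumbbell ε hε ℓ
    exact ⟨_, MetricGraph.dumbbell_oneHalfLineNoTerminal,
      ⟨(none : Option Bool), MetricGraph.dumbbell_isCutEdge, h1⟩,
      MetricGraph.dumbbell_bddAbove_quotients, h2⟩
  · obtain ⟨N, hN, h1, h2, h3⟩ := MetricGraph.exists_rose ε hε L
    exact ⟨_, MetricGraph.rose_oneHalfLineNoTerminal hN,
      by simpa using MetricGraph.rose_coreDiam_le N,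
      h1.trans_eq (MetricGraph.rose_coreLength N).symm, h2, h3⟩
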